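/- The maximal independent set problem requires $\Omega(n^{1.5})$ quantum queries to the adjacency matrix. Precisely: for every error bound $\varepsilon<1/2$ there are a constant $c>0$ and an $n_0$, depending only on $\varepsilon$, such that for all $n\ge n_0$ the following holds. Let $\mathcal A$ be a quantum query algorithm (arbitrary input-independent unitaries on a finite-dimensional space, alternating with applications of the query operator $|i,j,b,w\rangle\mapsto|i,j,b\oplus A_{i,j},w\rangle$, where $A$ is the adjacency matrix of the input graph, followed by a measurement) which, on every simple undirected graph $G$ with vertex set of size $n$, outputs with probability at least $1-\varepsilon$ a maximal independent set of $G$, that is, an independent set of vertices which is not properly contained in another independent set. Then $\mathcal A$ makes at least $c\,n^{1.5}$ queries. -/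

import Mathlib

open scoped Classical in
/-- One query to the adjacency matrix `A` of `G`, as a permutation of the computational basis
`|i, j, b, w⟩ ↦ |i, j, b ⊕ A i j, w⟩` (addition in `ZMod 2` is `⊕`). -/
noncomputable def queryPerm {n : ℕ} (W : Type) (G : SimpleGraph (Fin n)) :
    Equiv.Perm (Fin n × Fin n × ZMod 2 × W) where
  toFun x := (x.1, x.2.1, x.2.2.1 + G.adjMatrix (ZMod 2) x.1 x.2.1, x.2.2.2)
  invFun x := (x.1, x.2.1, x.2.2.1 - G.adjMatrix (ZMod 2) x.1 x.2.1, x.2.2.2)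
  left_inv x := by simp
  right_inv x := by simp

/-- The computational basis of a query algorithm on graphs with vertex set `Fin n`: two registers
for the row and the column of the queried matrix entry, one qubit for the answer, and a
work register of dimension `d`. -/
abbrev QBasis (n d : ℕ) : Type := Fin n × Fin n × ZMod 2 × Fin d

/-- The Hilbert space of pure states over the basis `QBasis n d`. -/
abbrev QState (n d : ℕ) : Type := EuclideanSpace ℂ (QBasis n d)

/-- The unitary query operator `O_G` of the graph `G`. -/
noncomputable def queryOp {n : ℕ} (d : ℕ) (G : SimpleGraph (Fin n)) :
    QState n d ≃ₗᵢ[ℂ] QState n d :=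
  LinearIsometryEquiv.piLpCongrLeft 2 ℂ ℂ (queryPerm (Fin d) G)

/-- A quantum query algorithm for graphs with vertex set `Fin n`, given by their adjacency matrix,
with outputs in `β`. It starts in a basis state, applies
`U_T O_G U_{T-1} O_G ⋯ O_G U_0`, where `T` is the number of queries and the unitaries `U_t` do not
depend on the input graph, measures all registers in the computational basis, and postprocesses
the outcome classically. (Unitaries with an index above `T` are never applied.) -/
structure QueryAlgorithm (n : ℕ) (β : Type) where
  /-- dimension of the work register -/
  workDim : ℕ
  /-- number of queries -/
  queries : ℕ
  /-- initial basis state -/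
  init : QBasis n workDim
  /-- input-independent unitaries -/
  unitary : ℕ → (QState n workDim ≃ₗᵢ[ℂ] QState n workDim)
  /-- classical postprocessing of the measurement outcome -/
  output : QBasis n workDim → β

namespace QueryAlgorithm

variable {n : ℕ} {β : Type}

/-- The state after `t` queries to `G`, followed by the unitary `U_t`. -/
noncomputable def stateAt (𝒜 : QueryAlgorithm n β) (G : SimpleGraph (Fin n)) :
    ℕ → QState n 𝒜.workDim
  | 0 => 𝒜.unitary 0 (EuclideanSpace.single 𝒜.init 1)
  | t + 1 => 𝒜.unitary (t + 1) (queryOp 𝒜.workDim G (stateAt 𝒜 G t))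

/-- The state that is measured at the end. -/
noncomputable def finalState (𝒜 : QueryAlgorithm n β) (G : SimpleGraph (Fin n)) :
    QState n 𝒜.workDim :=
  𝒜.stateAt G 𝒜.queries

open scoped Classical in
/-- The probability that the output of the algorithm on input `G` satisfies `P`. -/
noncomputable def prob (𝒜 : QueryAlgorithm n β) (G : SimpleGraph (Fin n)) (P : β → Prop) : ℝ :=
  ∑ x : QBasis n 𝒜.workDim with P (𝒜.output x), ‖𝒜.finalState G x‖ ^ 2

/-- On every graph, the algorithm outputs a valid answer with probability at least `1 - ε`,
where `R G y` says that `y` is a valid answer for the graph `G`. -/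
def SolvesWithError (𝒜 : QueryAlgorithm n β) (R : SimpleGraph (Fin n) → β → Prop) (ε : ℝ) : Prop :=
  ∀ G : SimpleGraph (Fin n), 1 - ε ≤ 𝒜.prob G (R G)

end QueryAlgorithm

/-- `S` is a maximal independent set of `G` (maximal under inclusion). -/
def IsMaximalIndependentSet {n : ℕ} (G : SimpleGraph (Fin n)) (S : Finset (Fin n)) : Prop :=
  Maximal (fun S' : Finset (Fin n) => G.IsIndepSet (S' : Set (Fin n))) S

/-! The proof is Ambainis' adversary argument. Pair a matching `G` of about n/4 edges with `G` plus
one edge uv between isolated vertices. Every maximal independent set of `G` contains u and v, so it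
is not independent after uv is added: the pair has no common answer, and the two final states must
have overlap bounded away from 1 (`norm_inner_le_of_measurement`).

The overlaps, summed over all pairs, start at the number of pairs. A query lowers each one only
through the amplitude on uv (`norm_inner_le_queryOp`). Since `G` has order n² extensions and each
larger matching order n predecessors, this amplitude is on average O(1/n²) on one side and O(1/n) on
the other (`mul_sum_pairMass_le`). Weighted AM-GM turns these into a relative loss of O(n^(-3/2))
per query. -/

/-- The squared amplitude that the state `ψ` puts on queries to the vertex pair `{u, v}`. -/
noncomputable def pairMass {n d : ℕ} (u v : Fin n) (ψ : QState n d) : ℝ :=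
  ∑ z : QBasis n d with (z.1 = u ∧ z.2.1 = v) ∨ (z.1 = v ∧ z.2.1 = u), ‖ψ z‖ ^ 2

theorem queryOp_apply {n d : ℕ} (G : SimpleGraph (Fin n)) (ψ : QState n d) (z : QBasis n d) :
    queryOp d G ψ z = ψ ((queryPerm (Fin d) G).symm z) := rfl

/-- Weighted arithmetic-geometric mean inequality. -/
theorem mul_le_weighted_sq {a : ℝ} (ha : 0 < a) (x y : ℝ) :
    x * y ≤ (a * x ^ 2 + a⁻¹ * y ^ 2) / 2 := by
  have h : 0 ≤ a⁻¹ * (a * x - y) ^ 2 := by positivity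
  have e : a⁻¹ * (a * x - y) ^ 2 = a * x ^ 2 - 2 * (x * y) + a⁻¹ * y ^ 2 := by
    field_simp
    ring
  linarith

/-- Each basis state queries one vertex pair, which is counted for at most two ordered pairs. -/
theorem sum_pairMass_le {n d : ℕ} (ψ : QState n d) (s : Finset (Fin n × Fin n)) :
    ∑ p ∈ s, pairMass p.1 p.2 ψ ≤ 2 * ‖ψ‖ ^ 2 := by
  classical
  unfold pairMass
  simp_rw [Finset.sum_filter]
  rw [Finset.sum_comm, EuclideanSpace.norm_sq_eq, Finset.mul_sum]
  refine Finset.sum_le_sum fun z _ => ?_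
  rw [← Finset.sum_filter, Finset.sum_const, nsmul_eq_mul]
  refine mul_le_mul_of_nonneg_right ?_ (by positivity)
  have h : (s.filter fun p => (z.1 = p.1 ∧ z.2.1 = p.2) ∨ (z.1 = p.2 ∧ z.2.1 = p.1)) ⊆
      {(z.1, z.2.1), (z.2.1, z.1)} := by
    rintro ⟨p, q⟩ hp
    simp only [Finset.mem_filter] at hp
    rcases hp.2 with ⟨rfl, rfl⟩ | ⟨rfl, rfl⟩ <;> simp
  exact_mod_cast (Finset.card_le_card h).trans Finset.card_le_two

/-- One query to graphs that differ only in the pair `{u, v}` decreases the overlap of the two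
states by at most a multiple of the amplitude that they put on that pair. -/
theorem norm_inner_le_queryOp {n d : ℕ} {G H : SimpleGraph (Fin n)} {u v : Fin n}
    (hGH : ∀ i j, ¬((i = u ∧ j = v) ∨ (i = v ∧ j = u)) → (G.Adj i j ↔ H.Adj i j))
    {a : ℝ} (ha : 0 < a) (ψ φ : QState n d) :
    ‖inner ℂ ψ φ‖ ≤ ‖inner ℂ (queryOp d G ψ) (queryOp d H φ)‖ +
      (a * pairMass u v ψ + a⁻¹ * pairMass u v φ) := by
  classical
  -- Reindexed by the query to `G`, the new overlap pairs `ψ z` with `φ (τ z)`; `τ` keeps the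
  -- queried entry and moves only points of `P`.
  set τ : Equiv.Perm (QBasis n d) := (queryPerm (Fin d) G).trans (queryPerm (Fin d) H).symm
    with hτ
  have τ1 : ∀ z, (τ z).1 = z.1 := fun z => rfl
  have τ2 : ∀ z, (τ z).2.1 = z.2.1 := fun z => rfl
  set P : Finset (QBasis n d) :=
    {z | (z.1 = u ∧ z.2.1 = v) ∨ (z.1 = v ∧ z.2.1 = u)} with hP
  have hfix : ∀ z, z ∉ P → τ z = z := by
    intro z hz
    have h := hGH z.1 z.2.1 (by simpa [hP] using hz)
    rw [hτ, Equiv.trans_apply, Equiv.symm_apply_eq]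
    simp [queryPerm, SimpleGraph.adjMatrix_apply, h]
  have e1 : inner ℂ (queryOp d G ψ) (queryOp d H φ) = ∑ z, inner ℂ (ψ z) (φ (τ z)) := by
    rw [PiLp.inner_apply, ← Equiv.sum_comp (queryPerm (Fin d) G)]
    refine Finset.sum_congr rfl fun z _ => ?_
    rw [queryOp_apply, queryOp_apply, Equiv.symm_apply_apply]
    rfl
  have e2 : inner ℂ ψ φ - inner ℂ (queryOp d G ψ) (queryOp d H φ) =
      ∑ z ∈ P, inner ℂ (ψ z) (φ z - φ (τ z)) := by
    rw [e1, PiLp.inner_apply, ← Finset.sum_sub_distrib]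
    simp_rw [← inner_sub_right]
    refine (Finset.sum_subset (Finset.subset_univ P) fun z _ hz => ?_).symm
    rw [hfix z hz, sub_self, inner_zero_right]
  have e3 : ∑ z ∈ P, ‖φ (τ z)‖ ^ 2 = ∑ z ∈ P, ‖φ z‖ ^ 2 := by
    refine Finset.sum_equiv τ (fun z => ?_) fun z _ => rfl
    simp [hP, τ1, τ2]
  have e4 : ‖∑ z ∈ P, inner ℂ (ψ z) (φ z - φ (τ z))‖ ≤
      a * pairMass u v ψ + a⁻¹ * pairMass u v φ := by
    calc ‖∑ z ∈ P, inner ℂ (ψ z) (φ z - φ (τ z))‖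
        ≤ ∑ z ∈ P, ((a * ‖ψ z‖ ^ 2 + a⁻¹ * ‖φ z‖ ^ 2) / 2 +
            (a * ‖ψ z‖ ^ 2 + a⁻¹ * ‖φ (τ z)‖ ^ 2) / 2) := by
          refine norm_sum_le_of_le _ fun z _ => ?_
          calc ‖inner ℂ (ψ z) (φ z - φ (τ z))‖ ≤ ‖ψ z‖ * ‖φ z - φ (τ z)‖ := norm_inner_le_norm _ _
            _ ≤ ‖ψ z‖ * (‖φ z‖ + ‖φ (τ z)‖) := by gcongr; exact norm_sub_le _ _
            _ = ‖ψ z‖ * ‖φ z‖ + ‖ψ z‖ * ‖φ (τ z)‖ := mul_add _ _ _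
            _ ≤ _ := add_le_add (mul_le_weighted_sq ha _ _) (mul_le_weighted_sq ha _ _)
      _ = a * pairMass u v ψ + a⁻¹ * pairMass u v φ := by
          unfold pairMass
          rw [← hP, Finset.sum_add_distrib, ← Finset.sum_div, ← Finset.sum_div,
            Finset.sum_add_distrib, Finset.sum_add_distrib, ← Finset.mul_sum, ← Finset.mul_sum,
            ← Finset.mul_sum, e3]
          ring
  have := norm_sub_norm_le (inner ℂ ψ φ) (inner ℂ (queryOp d G ψ) (queryOp d H φ))
  rw [e2] at this
  linarith

theorem norm_stateAt {n : ℕ} {β : Type} (𝒜 : QueryAlgorithm n β) (G : SimpleGraph (Fin n))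
    (t : ℕ) : ‖𝒜.stateAt G t‖ = 1 := by
  induction t with
  | zero => simp [QueryAlgorithm.stateAt]
  | succ t ih => simp [QueryAlgorithm.stateAt, ih]

/-- States that a measurement tells apart with error at most `ε` have small overlap. -/
theorem norm_inner_le_of_measurement {ι : Type*} [Fintype ι] [DecidableEq ι] {ε : ℝ}
    (h0 : 0 ≤ ε) (h1 : ε < 1 / 2)
    {ψ φ : EuclideanSpace ℂ ι} (hψ : ‖ψ‖ = 1) (hφ : ‖φ‖ = 1) {A B : Finset ι}
    (hAB : Disjoint A B) (hA : 1 - ε ≤ ∑ z ∈ A, ‖ψ z‖ ^ 2) (hB : 1 - ε ≤ ∑ z ∈ B, ‖φ z‖ ^ 2) :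
    ‖inner ℂ ψ φ‖ ≤ 1 - (1 - 2 * ε) ^ 2 / 4 := by
  -- A weight t = 1/2 + ε that stays positive at ε = 0, unlike the optimal √(ε/(1-ε)).
  set t : ℝ := 1 - (1 - 2 * ε) / 2 with ht
  have ht0 : 0 < t := by rw [ht]; linarith
  have sψ : ∑ z ∈ A, ‖ψ z‖ ^ 2 + ∑ z ∈ Aᶜ, ‖ψ z‖ ^ 2 = 1 := by
    rw [Finset.sum_add_sum_compl, ← EuclideanSpace.norm_sq_eq, hψ, one_pow]
  have sφ : ∑ z ∈ A, ‖φ z‖ ^ 2 + ∑ z ∈ Aᶜ, ‖φ z‖ ^ 2 = 1 := by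
    rw [Finset.sum_add_sum_compl, ← EuclideanSpace.norm_sq_eq, hφ, one_pow]
  have hB' : ∑ z ∈ B, ‖φ z‖ ^ 2 ≤ ∑ z ∈ Aᶜ, ‖φ z‖ ^ 2 :=
    Finset.sum_le_sum_of_subset_of_nonneg
      (fun z hz => Finset.mem_compl.2 fun h => Finset.disjoint_left.1 hAB h hz)
      fun _ _ _ => by positivity
  have key : ‖inner ℂ ψ φ‖ ≤
      (t * ∑ z ∈ A, ‖ψ z‖ ^ 2 + t⁻¹ * ∑ z ∈ A, ‖φ z‖ ^ 2) / 2 +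
      (t⁻¹ * ∑ z ∈ Aᶜ, ‖ψ z‖ ^ 2 + t * ∑ z ∈ Aᶜ, ‖φ z‖ ^ 2) / 2 := by
    rw [PiLp.inner_apply, Finset.mul_sum, Finset.mul_sum, Finset.mul_sum, Finset.mul_sum,
      ← Finset.sum_add_distrib, ← Finset.sum_add_distrib, Finset.sum_div, Finset.sum_div,
      ← Finset.sum_add_sum_compl A]
    refine (norm_add_le _ _).trans (add_le_add ?_ ?_) <;>
      refine norm_sum_le_of_le _ fun z _ => (norm_inner_le_norm _ _).trans ?_
    · exact mul_le_weighted_sq ht0 _ _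
    · simpa using mul_le_weighted_sq (inv_pos.2 ht0) ‖ψ z‖ ‖φ z‖
  set p := ∑ z ∈ A, ‖ψ z‖ ^ 2
  set q := ∑ z ∈ Aᶜ, ‖φ z‖ ^ 2
  have e1 : ∑ z ∈ A, ‖φ z‖ ^ 2 = 1 - q := by linarith
  have e2 : ∑ z ∈ Aᶜ, ‖ψ z‖ ^ 2 = 1 - p := by linarith
  rw [e1, e2] at key
  have hti : t ≤ t⁻¹ := by
    rw [← mul_le_mul_iff_left₀ ht0, inv_mul_cancel₀ ht0.ne']
    nlinarith
  -- Equivalent to (1/2 - ε)² ≥ 0.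
  have h2 : t⁻¹ * (2 * ε) ≤ t := by
    rw [inv_mul_le_iff₀ ht0]
    nlinarith
  have h3 : (t⁻¹ - t) * (2 - 2 * ε) ≤ (t⁻¹ - t) * (p + q) :=
    mul_le_mul_of_nonneg_left (by linarith) (by linarith)
  have h4 : t = 1 / 2 + ε := by rw [ht]; ring
  nlinarith

/-- A family of input pairs in which every first input occurs at least `m` times, with distinct
vertex pairs, puts average weight at most `2 / m` on the designated vertex pairs. -/
theorem mul_sum_pairMass_le {ι : Type*} {n d : ℕ} (s : Finset ι) (x : ι → SimpleGraph (Fin n))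
    (p : ι → Fin n × Fin n) (hinj : ∀ r ∈ s, ∀ r' ∈ s, x r = x r' → p r = p r' → r = r')
    (m : ℕ) (hm : ∀ r ∈ s, ∃ t : Finset ι, t ⊆ s ∧ (∀ r' ∈ t, x r' = x r) ∧ m ≤ t.card)
    (ψ : SimpleGraph (Fin n) → QState n d) (hψ : ∀ G, ‖ψ G‖ = 1) :
    m * ∑ r ∈ s, pairMass (p r).1 (p r).2 (ψ (x r)) ≤ 2 * s.card := by
  classical
  have h1 : ∑ r ∈ s, pairMass (p r).1 (p r).2 (ψ (x r)) ≤ 2 * (s.image x).card := by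
    rw [← Finset.sum_fiberwise_of_maps_to (g := x) (t := s.image x)
      fun r hr => Finset.mem_image_of_mem x hr, mul_comm, ← nsmul_eq_mul]
    refine Finset.sum_le_card_nsmul _ _ _ fun G _ => ?_
    calc ∑ r ∈ s with x r = G, pairMass (p r).1 (p r).2 (ψ (x r))
        = ∑ r ∈ s with x r = G, pairMass (p r).1 (p r).2 (ψ G) :=
          Finset.sum_congr rfl fun r hr => by rw [(Finset.mem_filter.1 hr).2]
      _ = ∑ q ∈ (s.filter fun r => x r = G).image p, pairMass q.1 q.2 (ψ G) := by
          rw [Finset.sum_image]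
          intro r hr r' hr' h
          obtain ⟨hr, e⟩ := Finset.mem_filter.1 hr
          obtain ⟨hr', e'⟩ := Finset.mem_filter.1 hr'
          exact hinj r hr r' hr' (e.trans e'.symm) h
      _ ≤ 2 * ‖ψ G‖ ^ 2 := sum_pairMass_le _ _
      _ = 2 := by rw [hψ]; norm_num
  -- Double counting: every fibre of `x` has at least `m` elements.
  have h2 : m * (s.image x).card ≤ s.card := by
    rw [Finset.card_eq_sum_card_image x s, mul_comm, ← smul_eq_mul]
    refine Finset.card_nsmul_le_sum _ _ _ fun G hG => ?_
    obtain ⟨r, hr, rfl⟩ := Finset.mem_image.1 hG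
    obtain ⟨t, ht, hx, hc⟩ := hm r hr
    exact hc.trans (Finset.card_le_card fun r' h => Finset.mem_filter.2 ⟨ht h, hx r' h⟩)
  have h2' : (m : ℝ) * (s.image x).card ≤ s.card := by exact_mod_cast h2
  have := mul_le_mul_of_nonneg_left h1 (Nat.cast_nonneg (α := ℝ) m)
  linarith

/-- The adversary bound for a family of pairs of graphs `x r`, `y r` that differ only in one vertex
pair and have no valid answer in common. -/
theorem adversary_bound {ι β : Type} {n : ℕ} (𝒜 : QueryAlgorithm n β)
    {Q : SimpleGraph (Fin n) → β → Prop} {ε : ℝ} (h0 : 0 ≤ ε) (h1 : ε < 1 / 2)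
    (h𝒜 : 𝒜.SolvesWithError Q ε) {s : Finset ι} (hs : s.Nonempty)
    {x y : ι → SimpleGraph (Fin n)} {p : ι → Fin n × Fin n}
    (hQ : ∀ r ∈ s, ∀ b, Q (x r) b → ¬ Q (y r) b)
    (hxy : ∀ r ∈ s, ∀ i j, ¬((i = (p r).1 ∧ j = (p r).2) ∨ (i = (p r).2 ∧ j = (p r).1)) →
      ((x r).Adj i j ↔ (y r).Adj i j))
    (hx : ∀ r ∈ s, ∀ r' ∈ s, x r = x r' → p r = p r' → r = r')
    (hy : ∀ r ∈ s, ∀ r' ∈ s, y r = y r' → p r = p r' → r = r')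
    {m m' : ℕ} (hm0 : 0 < m) (hm0' : 0 < m')
    (hm : ∀ r ∈ s, ∃ t : Finset ι, t ⊆ s ∧ (∀ r' ∈ t, x r' = x r) ∧ m ≤ t.card)
    (hm' : ∀ r ∈ s, ∃ t : Finset ι, t ⊆ s ∧ (∀ r' ∈ t, y r' = y r) ∧ m' ≤ t.card)
    {a : ℝ} (ha : 0 < a) :
    (1 - 2 * ε) ^ 2 / 4 ≤ 𝒜.queries * (a * (2 / m) + a⁻¹ * (2 / m')) := by
  classical
  set W : ℕ → ℝ := fun t => ∑ r ∈ s, ‖inner ℂ (𝒜.stateAt (x r) t) (𝒜.stateAt (y r) t)‖ with hW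
  set D : ℝ := s.card * (a * (2 / m) + a⁻¹ * (2 / m')) with hD
  have hstep : ∀ t, W t ≤ W (t + 1) + D := by
    intro t
    have hA := mul_sum_pairMass_le s x p hx m hm (fun G => 𝒜.stateAt G t)
      fun G => norm_stateAt 𝒜 G t
    have hB := mul_sum_pairMass_le s y p hy m' hm' (fun G => 𝒜.stateAt G t)
      fun G => norm_stateAt 𝒜 G t
    have hmr : (0 : ℝ) < m := by exact_mod_cast hm0
    have hmr' : (0 : ℝ) < m' := by exact_mod_cast hm0'
    rw [← le_div_iff₀' hmr] at hA
    rw [← le_div_iff₀' hmr'] at hB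
    calc W t ≤ ∑ r ∈ s, (‖inner ℂ (𝒜.stateAt (x r) (t + 1)) (𝒜.stateAt (y r) (t + 1))‖ +
          (a * pairMass (p r).1 (p r).2 (𝒜.stateAt (x r) t) +
            a⁻¹ * pairMass (p r).1 (p r).2 (𝒜.stateAt (y r) t))) := by
          refine Finset.sum_le_sum fun r hr => ?_
          have := norm_inner_le_queryOp (hxy r hr) ha (𝒜.stateAt (x r) t) (𝒜.stateAt (y r) t)
          -- The unitary between queries is the same for both inputs, so it preserves the overlap.
          rwa [← LinearIsometryEquiv.inner_map_map (𝒜.unitary (t + 1)) (queryOp _ _ _)] at this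
      _ = W (t + 1) + (a * ∑ r ∈ s, pairMass (p r).1 (p r).2 (𝒜.stateAt (x r) t) +
            a⁻¹ * ∑ r ∈ s, pairMass (p r).1 (p r).2 (𝒜.stateAt (y r) t)) := by
          rw [Finset.sum_add_distrib, Finset.sum_add_distrib, Finset.mul_sum, Finset.mul_sum]
      _ ≤ W (t + 1) + (a * (2 * s.card / m) + a⁻¹ * (2 * s.card / m')) := by gcongr
      _ = W (t + 1) + D := by rw [hD]; ring
  have hind : ∀ t : ℕ, W 0 ≤ W t + t * D := by
    intro t
    induction t with
    | zero => simp
    | succ t ih => push_cast; linarith [hstep t]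
  have hstart : W 0 = s.card := by
    have h : ∀ G H, ‖inner ℂ (𝒜.stateAt G 0) (𝒜.stateAt H 0)‖ = 1 := by
      intro G H
      rw [show 𝒜.stateAt H 0 = 𝒜.stateAt G 0 from rfl, inner_self_eq_norm_sq_to_K, norm_stateAt]
      simp
    simp [hW, h]
  have hfin : W 𝒜.queries ≤ s.card * (1 - (1 - 2 * ε) ^ 2 / 4) := by
    rw [← nsmul_eq_mul]
    refine Finset.sum_le_card_nsmul _ _ _ fun r hr => ?_
    refine norm_inner_le_of_measurement h0 h1 (norm_stateAt _ _ _) (norm_stateAt _ _ _) ?_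
      (h𝒜 (x r)) (h𝒜 (y r))
    refine Finset.disjoint_left.2 fun z hz hz' => ?_
    exact hQ r hr _ (Finset.mem_filter.1 hz).2 (Finset.mem_filter.1 hz').2
  have hc : (0 : ℝ) < s.card := by exact_mod_cast hs.card_pos
  have := hind 𝒜.queries
  rw [hstart] at this
  refine le_of_mul_le_mul_left ?_ hc
  rw [hD] at this
  linarith

/-! ### Matchings and their one-edge extensions -/

/-- A maximal independent set contains all isolated vertices. -/
theorem IsMaximalIndependentSet.mem_of_notMem_support {n : ℕ} {G : SimpleGraph (Fin n)}
    {S : Finset (Fin n)} (hS : IsMaximalIndependentSet G S) {u : Fin n} (hu : u ∉ G.support) :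
    u ∈ S := by
  have hi : ∀ w, ¬ G.Adj u w := fun w hw => hu ⟨w, hw⟩
  refine hS.le_of_ge (y := insert u S) ?_ (Finset.subset_insert u S) (Finset.mem_insert_self u S)
  rw [Finset.coe_insert]
  exact Set.pairwise_insert.2 ⟨hS.prop, fun w _ _ => ⟨hi w, fun h => hi w h.symm⟩⟩

/-- The edges of `G` form a matching, with `k` edges. -/
structure IsMatchingGraph {n : ℕ} (G : SimpleGraph (Fin n)) (k : ℕ) : Prop where
  unique : ∀ i j l, G.Adj i j → G.Adj i l → j = l
  ncard_support : G.support.ncard = 2 * k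

namespace IsMatchingGraph

variable {n k : ℕ} {G : SimpleGraph (Fin n)}

theorem support_sup_edge {u v : Fin n} (huv : u ≠ v) :
    (G ⊔ SimpleGraph.edge u v).support = insert u (insert v G.support) := by
  ext w
  simp only [SimpleGraph.mem_support, SimpleGraph.sup_adj, SimpleGraph.edge_adj, Set.mem_insert_iff]
  constructor
  · rintro ⟨z, h | ⟨⟨rfl, rfl⟩ | ⟨rfl, rfl⟩, _⟩⟩
    · exact Or.inr (Or.inr ⟨z, h⟩)
    · simp
    · simp
  · rintro (rfl | rfl | ⟨z, h⟩)
    · exact ⟨v, by simp [huv]⟩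
    · exact ⟨u, by simp [huv.symm]⟩
    · exact ⟨z, Or.inl h⟩

theorem sup_edge (hG : IsMatchingGraph G k) {u v : Fin n} (huv : u ≠ v)
    (hu : u ∉ G.support) (hv : v ∉ G.support) :
    IsMatchingGraph (G ⊔ SimpleGraph.edge u v) (k + 1) where
  unique i j l hj hl := by
    have hu' : ∀ w, ¬ G.Adj u w := fun w hw => hu ⟨w, hw⟩
    have hv' : ∀ w, ¬ G.Adj v w := fun w hw => hv ⟨w, hw⟩
    have := hG.unique i j l
    simp only [SimpleGraph.sup_adj, SimpleGraph.edge_adj] at hj hl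
    grind
  ncard_support := by
    rw [support_sup_edge huv, Set.ncard_insert_of_notMem (by simp [huv, hu]),
      Set.ncard_insert_of_notMem hv, hG.ncard_support]
    ring

theorem notMem_support_sdiff_edge (hG : IsMatchingGraph G k) {u v : Fin n} (h : G.Adj u v) :
    u ∉ (G \ SimpleGraph.edge u v).support := by
  rintro ⟨w, hw⟩
  simp only [SimpleGraph.sdiff_adj, SimpleGraph.edge_adj] at hw
  obtain rfl := hG.unique u v w h hw.1
  exact hw.2 ⟨by simp, h.ne⟩

theorem sdiff_edge (hG : IsMatchingGraph G (k + 1)) {u v : Fin n} (h : G.Adj u v) :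
    IsMatchingGraph (G \ SimpleGraph.edge u v) k where
  unique i j l hj hl := hG.unique i j l hj.1 hl.1
  ncard_support := by
    have hu := hG.notMem_support_sdiff_edge h
    have hv := hG.notMem_support_sdiff_edge h.symm
    rw [SimpleGraph.edge_comm] at hv
    have e := support_sup_edge (G := G \ SimpleGraph.edge u v) h.ne
    rw [sdiff_sup_cancel ((SimpleGraph.edge_le_iff _).2 (Or.inr h))] at e
    have c := hG.ncard_support
    rw [e, Set.ncard_insert_of_notMem (by simp [h.ne, hu]), Set.ncard_insert_of_notMem hv] at c
    omega

theorem ncard_compl_support (hG : IsMatchingGraph G k) : G.supportᶜ.ncard = n - 2 * k := by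
  rw [Set.ncard_compl, hG.ncard_support, Nat.card_eq_fintype_card, Fintype.card_fin]

theorem exists_of_two_mul_le (h : 2 * k ≤ n) :
    ∃ G : SimpleGraph (Fin n), IsMatchingGraph G k := by
  induction k with
  | zero => exact ⟨⊥, fun i j l hj => hj.elim, by simp⟩
  | succ k ih =>
    obtain ⟨G, hG⟩ := ih (by omega)
    have hc := hG.ncard_compl_support
    obtain ⟨u, hu, v, hv, huv⟩ := (Set.one_lt_ncard (s := G.supportᶜ)).1 (by omega)
    exact ⟨_, hG.sup_edge huv hu hv⟩

end IsMatchingGraph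

open scoped Classical in
/-- The matchings `G` with `k` edges, each with an ordered pair of isolated vertices. -/
noncomputable def matchingExtensions (n k : ℕ) :
    Finset (SimpleGraph (Fin n) × (Fin n × Fin n)) :=
  {r | IsMatchingGraph r.1 k ∧ r.2.1 ≠ r.2.2 ∧ r.2.1 ∉ r.1.support ∧ r.2.2 ∉ r.1.support}

theorem mem_matchingExtensions {n k : ℕ} {r : SimpleGraph (Fin n) × (Fin n × Fin n)} :
    r ∈ matchingExtensions n k ↔ IsMatchingGraph r.1 k ∧ r.2.1 ≠ r.2.2 ∧
      r.2.1 ∉ r.1.support ∧ r.2.2 ∉ r.1.support := by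
  simp [matchingExtensions]

theorem matchingExtensions_nonempty {n k : ℕ} (h : 2 * (k + 1) ≤ n) :
    (matchingExtensions n k).Nonempty := by
  obtain ⟨G, hG⟩ := IsMatchingGraph.exists_of_two_mul_le (n := n) (k := k) (by omega)
  have hc := hG.ncard_compl_support
  obtain ⟨u, hu, v, hv, huv⟩ := (Set.one_lt_ncard (s := G.supportᶜ)).1 (by omega)
  exact ⟨(G, (u, v)), mem_matchingExtensions.2 ⟨hG, huv, hu, hv⟩⟩

theorem exists_matchingExtensions_fst_eq {n k : ℕ} {G : SimpleGraph (Fin n)}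
    (hG : IsMatchingGraph G k) :
    ∃ t ⊆ matchingExtensions n k, (∀ r ∈ t, r.1 = G) ∧
      (n - 2 * k) * (n - 2 * k) - (n - 2 * k) ≤ t.card := by
  classical
  refine ⟨(G.supportᶜ.toFinset.offDiag).image (Prod.mk G), ?_, ?_, ?_⟩
  · intro r hr
    obtain ⟨q, hq, rfl⟩ := Finset.mem_image.1 hr
    obtain ⟨hu, hv, huv⟩ := Finset.mem_offDiag.1 hq
    exact mem_matchingExtensions.2 ⟨hG, huv, by simpa using hu, by simpa using hv⟩
  · intro r hr
    obtain ⟨q, hq, rfl⟩ := Finset.mem_image.1 hr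
    rfl
  · rw [Finset.card_image_of_injective _ (Prod.mk_right_injective G), Finset.offDiag_card,
      ← Set.ncard_eq_toFinset_card', hG.ncard_compl_support]

/-- Each of the 2(k+1) matched vertices selects its edge, oriented away from it; deleting that edge
gives a predecessor. -/
theorem exists_matchingExtensions_sup_edge_eq {n k : ℕ} {H : SimpleGraph (Fin n)}
    (hH : IsMatchingGraph H (k + 1)) :
    ∃ t ⊆ matchingExtensions n k, (∀ r ∈ t, r.1 ⊔ SimpleGraph.edge r.2.1 r.2.2 = H) ∧
      2 * (k + 1) ≤ t.card := by
  classical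
  have hp : ∀ i : H.support, ∃ j, H.Adj i j := fun i => i.2
  choose f hf using hp
  refine ⟨Finset.univ.image fun i : H.support => (H \ SimpleGraph.edge i.1 (f i), (i.1, f i)),
    ?_, ?_, ?_⟩
  · intro r hr
    obtain ⟨i, -, rfl⟩ := Finset.mem_image.1 hr
    refine mem_matchingExtensions.2 ⟨hH.sdiff_edge (hf i), (hf i).ne,
      hH.notMem_support_sdiff_edge (hf i), ?_⟩
    have := hH.notMem_support_sdiff_edge (hf i).symm
    rwa [SimpleGraph.edge_comm] at this
  · intro r hr
    obtain ⟨i, -, rfl⟩ := Finset.mem_image.1 hr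
    exact sdiff_sup_cancel ((SimpleGraph.edge_le_iff _).2 (Or.inr (hf i)))
  · rw [Finset.card_image_of_injective, Finset.card_univ, ← hH.ncard_support,
      ← Nat.card_coe_set_eq, Nat.card_eq_fintype_card]
    intro i j h
    exact Subtype.ext (congrArg (fun r => r.2.1) h)

/-- The added edge was absent before, so deleting it recovers the smaller matching. -/
theorem sup_edge_injOn_matchingExtensions {n k : ℕ} {r r' : SimpleGraph (Fin n) × (Fin n × Fin n)}
    (hr : r ∈ matchingExtensions n k) (hr' : r' ∈ matchingExtensions n k)
    (h : r.1 ⊔ SimpleGraph.edge r.2.1 r.2.2 = r'.1 ⊔ SimpleGraph.edge r'.2.1 r'.2.2)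
    (hp : r.2 = r'.2) : r = r' := by
  obtain ⟨G, u, v⟩ := r
  obtain ⟨G', u', v'⟩ := r'
  obtain ⟨rfl, rfl⟩ := Prod.mk.inj hp
  have h1 : ¬ G.Adj u v := fun h => (mem_matchingExtensions.1 hr).2.2.1 ⟨v, h⟩
  have h2 : ¬ G'.Adj u v := fun h => (mem_matchingExtensions.1 hr').2.2.1 ⟨v, h⟩
  have e := congrArg (· \ SimpleGraph.edge u v) h
  simp only [sup_sdiff_right_self, SimpleGraph.sdiff_edge _ h1, SimpleGraph.sdiff_edge _ h2] at e
  rw [e]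

theorem IsMaximalIndependentSet.not_sup_edge {n : ℕ} {G : SimpleGraph (Fin n)}
    {S : Finset (Fin n)} (hS : IsMaximalIndependentSet G S) {u v : Fin n} (huv : u ≠ v)
    (hu : u ∉ G.support) (hv : v ∉ G.support) :
    ¬ IsMaximalIndependentSet (G ⊔ SimpleGraph.edge u v) S := fun h =>
  h.prop (hS.mem_of_notMem_support hu) (hS.mem_of_notMem_support hv) huv
    (by simp [SimpleGraph.edge_adj, huv])

/-! ### The choice of parameters -/

theorem queries_lower_bound {ε : ℝ} (h0 : 0 ≤ ε) (h1 : ε < 1 / 2) {n : ℕ} (hn : 4 ≤ n)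
    (𝒜 : QueryAlgorithm n (Finset (Fin n))) (h𝒜 : 𝒜.SolvesWithError IsMaximalIndependentSet ε) :
    (1 - 2 * ε) ^ 2 / 80 * (n : ℝ) ^ (3 / 2 : ℝ) ≤ 𝒜.queries := by
  -- With k = ⌊n/4⌋, both the number `I` of isolated vertices and 2(k+1) are at least n/2.
  obtain ⟨k, hk, hk'⟩ : ∃ k, 4 * k ≤ n ∧ n < 4 * k + 4 := ⟨n / 4, by omega, by omega⟩
  obtain ⟨I, hI⟩ : ∃ I, I = n - 2 * k := ⟨_, rfl⟩
  have hIn : (n : ℝ) ≤ 2 * I := by exact_mod_cast (by omega : n ≤ 2 * I)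
  have hI2 : (2 : ℝ) ≤ I := by exact_mod_cast (by omega : 2 ≤ I)
  have hn0 : (0 : ℝ) < n := by exact_mod_cast (by omega : 0 < n)
  have hmr : (n : ℝ) ^ 2 / 8 ≤ ((I * I - I : ℕ) : ℝ) := by
    rw [Nat.cast_sub (Nat.le_mul_self I)]
    push_cast
    nlinarith
  have hmr' : (n : ℝ) / 2 ≤ ((2 * (k + 1) : ℕ) : ℝ) := by
    rw [div_le_iff₀ two_pos]
    exact_mod_cast (by omega : n ≤ 2 * (k + 1) * 2)
  have hm0 : 0 < I * I - I := by
    have : (0 : ℝ) < ((I * I - I : ℕ) : ℝ) := lt_of_lt_of_le (by positivity) hmr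
    exact_mod_cast this
  -- The weight √n has the order of √(m/m'), which balances the two terms: 16/n^(3/2) + 4/n^(3/2)
  -- gives the 20 below, hence 80 = 4 · 20.
  have ha : 0 < √(n : ℝ) := Real.sqrt_pos.2 hn0
  have key := adversary_bound 𝒜 h0 h1 h𝒜 (matchingExtensions_nonempty (n := n) (k := k) (by omega))
    (x := fun r => r.1) (y := fun r => r.1 ⊔ SimpleGraph.edge r.2.1 r.2.2) (p := fun r => r.2)
    (m := I * I - I) (m' := 2 * (k + 1))
    (fun r hr S hS => by
      obtain ⟨-, huv, hu, hv⟩ := mem_matchingExtensions.1 hr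
      exact hS.not_sup_edge huv hu hv)
    (fun r _ i j hij => by simp [SimpleGraph.edge_adj, hij])
    (fun r _ r' _ => Prod.ext)
    (fun r hr r' hr' => sup_edge_injOn_matchingExtensions hr hr')
    hm0 (by omega)
    (fun r hr => hI ▸ exists_matchingExtensions_fst_eq (mem_matchingExtensions.1 hr).1)
    (fun r hr => by
      obtain ⟨hG, huv, hu, hv⟩ := mem_matchingExtensions.1 hr
      exact exists_matchingExtensions_sup_edge_eq (hG.sup_edge huv hu hv))
    ha
  have hsq : √(n : ℝ) ^ 2 = n := Real.sq_sqrt hn0.le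
  have hpow : (n : ℝ) ^ (3 / 2 : ℝ) = n * √(n : ℝ) := by
    rw [Real.sqrt_eq_rpow, show (3 / 2 : ℝ) = 1 + 1 / 2 by norm_num, Real.rpow_add hn0,
      Real.rpow_one]
  have hD : √(n : ℝ) * (2 / ((I * I - I : ℕ) : ℝ)) + (√(n : ℝ))⁻¹ * (2 / ((2 * (k + 1) : ℕ) : ℝ)) ≤
      20 / (n * √(n : ℝ)) := by
    calc _ ≤ √(n : ℝ) * (2 / ((n : ℝ) ^ 2 / 8)) + (√(n : ℝ))⁻¹ * (2 / ((n : ℝ) / 2)) := by gcongr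
      _ = 20 / (n * √(n : ℝ)) := by
        field_simp
        rw [hsq]
        ring
  have key2 := key.trans (mul_le_mul_of_nonneg_left hD (Nat.cast_nonneg _))
  rw [← mul_div_assoc, le_div_iff₀ (by positivity)] at key2
  rw [hpow]
  linarith

theorem mainTheorem2 (ε : ℝ) (hε : ε < 1 / 2) :
    ∃ c : ℝ, 0 < c ∧ ∃ n₀ : ℕ, ∀ n : ℕ, n₀ ≤ n →
      ∀ 𝒜 : QueryAlgorithm n (Finset (Fin n)),
        𝒜.SolvesWithError IsMaximalIndependentSet ε →
          c * (n : ℝ) ^ (3 / 2 : ℝ) ≤ (𝒜.queries : ℝ) := by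
  -- The adversary bound needs a nonnegative error; a negative ε is relaxed to 0.
  have h1 : max ε 0 < 1 / 2 := max_lt hε (by norm_num)
  refine ⟨(1 - 2 * max ε 0) ^ 2 / 80, ?_, 4, fun n hn 𝒜 h𝒜 => ?_⟩
  · have : 0 < 1 - 2 * max ε 0 := by linarith
    positivity
  · refine queries_lower_bound (le_max_right ε 0) h1 hn 𝒜 fun G => ?_
    exact (sub_le_sub_left (le_max_left ε 0) 1).trans (h𝒜 G)
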